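/- Let $N\ge 1$, $n$ and $m_1,\dots,m_N$ be nonnegative integers. Consider the structured switched linear system $\dot x(t)=A_{\sigma(t)}x(t)+B_{\sigma(t)}u_{\sigma(t)}(t)$, where for $i=1,\dots,N$ the $n\times n$ matrix $A_i$ and the $n\times m_i$ matrix $B_i$ are structured, i.e. each of their entries is either fixed to zero or a free parameter (a "nonzero entry"), independent of all others, with arbitrary real values, zero included. A realization assigns real values to the free parameters. A realization is controllable if for every $x_0\in\mathbb R^n$ there are a finite time $t_f>0$, a switching signal $\sigma:[0,t_f)\to\{1,\dots,N\}$ (piecewise constant with finitely many switches) and piecewise continuous inputs $u_i:[0,t_f)\to\mathbb R^{m_i}$ such that the solution with $x(0)=x_0$ satisfies $x(t_f)=0$. The structured system is structurally controllable if it has a controllable realization. The colored union graph $\mathcal G_c$ has state vertices $x_1,\dots,x_n$ and input vertices $u^i_k$ ($1\le i\le N$, $1\le k\le m_i$). It has an edge $(x_k,x_j)$ of color $i$ for each nonzero entry $(j,k)$ of $A_i$, and an edge $(u^i_k,x_j)$ of color $i$ for each nonzero entry $(j,k)$ of $B_i$; edges of different colors between the same vertices are distinct. A set of edges is S-disjoint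 if their heads are pairwise distinct and any two distinct edges with the same tail have different colors. A state vertex is input-reachable if $\mathcal G_c$ has a directed path to it from some input vertex. A cycle is a closed walk with no repeated vertex except that its start equals its end (self-loops are cycles; cycles are counted up to the choice of the starting vertex). A subgraph $(V_s,E_s)$ of $\mathcal G_c$ is a generalized stem if it contains exactly one input vertex and no cycle, each state vertex in $V_s$ has exactly one ingoing edge in $E_s$, and $E_s$ is S-disjoint. It is a generalized bud if it contains no input vertex and exactly one cycle, every state vertex in $V_s$ is input-reachable in $\mathcal G_c$, each state vertex in $V_s$ has exactly one ingoing edge in $E_s$, and $E_s$ is S-disjoint. Theorem. If $\mathcal G_c$ contains a collection of pairwise vertex-disjoint generalized stems and generalized buds that covers all state vertices $x_1,\dots,x_n$, then the structured switched system is structurally controllable. -/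

import Mathlib

open Filter Topology

/-! ### Switched linear systems and their controllability -/

/-- `f` is piecewise continuous on `[a, b)`: it is continuous there outside a finite set and has
(finite) one-sided limits everywhere.  For a function with values in a discrete space such as
`Fin N` this says that `f` is piecewise constant with finitely many jumps. -/
def PiecewiseContinuous {E : Type*} [TopologicalSpace E] (f : ℝ → E) (a b : ℝ) : Prop :=
  ∃ S : Finset ℝ,
    (∀ t ∈ Set.Ico a b, t ∉ S → ContinuousWithinAt f (Set.Ico a b) t) ∧
    (∀ t ∈ Set.Ico a b, ∃ l : E, Tendsto f (𝓝[>] t) (𝓝 l)) ∧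
    (∀ t ∈ Set.Ioc a b, ∃ l : E, Tendsto f (𝓝[<] t) (𝓝 l))

/-- The numerical data `(A_i, B_i)`, `i = 1, …, N`, of a switched linear system with state space
`ℝⁿ` and input spaces `ℝ^{m_i}`. -/
structure SwitchedSystem (n N : ℕ) (m : Fin N → ℕ) where
  A : Fin N → Matrix (Fin n) (Fin n) ℝ
  B : (i : Fin N) → Matrix (Fin n) (Fin (m i)) ℝ

namespace SwitchedSystem

variable {n N : ℕ} {m : Fin N → ℕ}

/-- `x` solves `x'(t) = A_{σ(t)} x(t) + B_{σ(t)} u_{σ(t)}(t)` on `[0, tf]`: it is continuous, and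
satisfies the differential equation outside a finite set of times (needed because of the jumps of
the switching signal and of the inputs). -/
def IsTrajectory (Q : SwitchedSystem n N m) (tf : ℝ) (σ : ℝ → Fin N)
    (u : (i : Fin N) → ℝ → (Fin (m i) → ℝ)) (x : ℝ → (Fin n → ℝ)) : Prop :=
  ContinuousOn x (Set.Icc 0 tf) ∧
  ∃ S : Finset ℝ, ∀ t ∈ Set.Ioo 0 tf, t ∉ S →
    HasDerivAt x ((Q.A (σ t)).mulVec (x t) + (Q.B (σ t)).mulVec (u (σ t) t)) t

/-- The state `x₀` can be steered to `0` in finite time by a piecewise constant switching signal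
and piecewise continuous inputs. -/
def IsControllableState (Q : SwitchedSystem n N m) (x₀ : Fin n → ℝ) : Prop :=
  ∃ tf : ℝ, 0 < tf ∧ ∃ σ : ℝ → Fin N, PiecewiseContinuous σ 0 tf ∧
    ∃ u : (i : Fin N) → ℝ → (Fin (m i) → ℝ), (∀ i, PiecewiseContinuous (u i) 0 tf) ∧
      ∃ x : ℝ → (Fin n → ℝ), Q.IsTrajectory tf σ u x ∧ x 0 = x₀ ∧ x tf = 0

/-- The set of controllable states. -/
def controllableSet (Q : SwitchedSystem n N m) : Set (Fin n → ℝ) :=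
  {x₀ | Q.IsControllableState x₀}

/-- Every state is controllable. -/
def IsControllable (Q : SwitchedSystem n N m) : Prop :=
  Q.controllableSet = Set.univ

end SwitchedSystem

/-! ### Structured systems -/

/-- A structured switched system: `A i j k` (resp. `B i j k`) says that the `(j, k)` entry of the
`i`-th structured matrix is a free ("nonzero") entry; the other entries are fixed to be zero. -/
structure StructuredSystem (n N : ℕ) (m : Fin N → ℕ) where
  A : Fin N → Matrix (Fin n) (Fin n) Prop
  B : (i : Fin N) → Matrix (Fin n) (Fin (m i)) Prop

/-- The vertices of the colored union graph: the state vertices `x_1, …, x_n` and, for every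
subsystem `i`, its own input vertices `u^i_1, …, u^i_{m_i}`. -/
inductive Vertex (n N : ℕ) (m : Fin N → ℕ) where
  | state (j : Fin n) : Vertex n N m
  | input (i : Fin N) (k : Fin (m i)) : Vertex n N m

/-- A directed edge from `tail` to `head` with a color index. -/
@[ext]
structure ColoredEdge (n N : ℕ) (m : Fin N → ℕ) where
  tail : Vertex n N m
  head : Vertex n N m
  color : Fin N

namespace StructuredSystem

variable {n N : ℕ} {m : Fin N → ℕ}

/-- `Q` is obtained from the structured system by assigning real values (possibly zero) to the
free entries. -/
def IsRealization (P : StructuredSystem n N m) (Q : SwitchedSystem n N m) : Prop :=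
  (∀ i j k, ¬ P.A i j k → Q.A i j k = 0) ∧ (∀ i j k, ¬ P.B i j k → Q.B i j k = 0)

/-- Structural controllability: some realization is controllable. -/
def IsStructurallyControllable (P : StructuredSystem n N m) : Prop :=
  ∃ Q : SwitchedSystem n N m, P.IsRealization Q ∧ Q.IsControllable

/-! ### The colored union graph -/

/-- The edges of the colored union graph: an edge `(x_k, x_j)` of color `i` for each free entry
`(j, k)` of `A_i`, and an edge `(u^i_k, x_j)` of color `i` for each free entry `(j, k)` of `B_i`.
Edges with equal ends and different colors are different. -/
inductive IsEdge (P : StructuredSystem n N m) : ColoredEdge n N m → Prop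
  | state (i : Fin N) (j k : Fin n) (h : P.A i j k) : IsEdge P ⟨.state k, .state j, i⟩
  | input (i : Fin N) (j : Fin n) (k : Fin (m i)) (h : P.B i j k) :
      IsEdge P ⟨.input i k, .state j, i⟩

/-- There is an edge of some color from `v` to `w`. -/
def Adj (P : StructuredSystem n N m) (v w : Vertex n N m) : Prop :=
  ∃ i : Fin N, P.IsEdge ⟨v, w, i⟩

/-- The vertex `v` can be reached from some input vertex along edges of the colored union
graph. -/
def InputReachable (P : StructuredSystem n N m) (v : Vertex n N m) : Prop :=
  ∃ (i : Fin N) (k : Fin (m i)), Relation.ReflTransGen P.Adj (.input i k) v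

/-- A subgraph of the colored union graph. -/
structure Subgraph (P : StructuredSystem n N m) where
  verts : Set (Vertex n N m)
  edges : Set (ColoredEdge n N m)
  isEdge : ∀ e ∈ edges, P.IsEdge e
  tail_mem : ∀ e ∈ edges, e.tail ∈ verts
  head_mem : ∀ e ∈ edges, e.head ∈ verts

/-- Edges are S-disjoint if their heads are all distinct and edges with the same tail have
different color indices. -/
def SDisjoint (E : Set (ColoredEdge n N m)) : Prop :=
  E.Pairwise fun e f => e.head ≠ f.head ∧ (e.tail = f.tail → e.color ≠ f.color)

namespace Subgraph

variable {P : StructuredSystem n N m}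

/-- `c` is a cycle of the subgraph: a nonempty cyclic sequence of edges (a list up to rotation),
each of which ends where the next one starts, passing through pairwise distinct vertices.
Self-loops are cycles. -/
def IsCycle (G : P.Subgraph) (c : Cycle (ColoredEdge n N m)) : Prop :=
  c ≠ Cycle.nil ∧ (∀ e ∈ c, e ∈ G.edges) ∧ c.Chain (fun e f => e.head = f.tail) ∧
    (c.map ColoredEdge.head).Nodup

/-- Generalized stems. -/
structure IsGeneralizedStem (G : P.Subgraph) : Prop where
  one_input : ∃! u : (i : Fin N) × Fin (m i), Vertex.input u.1 u.2 ∈ G.verts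
  no_cycle : ∀ c, ¬ G.IsCycle c
  one_ingoing : ∀ j : Fin n, Vertex.state j ∈ G.verts → ∃! e, e ∈ G.edges ∧ e.head = .state j
  sDisjoint : SDisjoint G.edges

/-- Generalized buds. -/
structure IsGeneralizedBud (G : P.Subgraph) : Prop where
  no_input : ∀ (i : Fin N) (k : Fin (m i)), Vertex.input i k ∉ G.verts
  one_cycle : ∃! c, G.IsCycle c
  reachable : ∀ j : Fin n, Vertex.state j ∈ G.verts → P.InputReachable (.state j)
  one_ingoing : ∀ j : Fin n, Vertex.state j ∈ G.verts → ∃! e, e ∈ G.edges ∧ e.head = .state j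
  sDisjoint : SDisjoint G.edges

end Subgraph

/-- There is a collection of vertex-disjoint generalized stems and generalized buds that cover
the set `Xs` of state vertices. -/
def CoveredByGeneralizedCactus (P : StructuredSystem n N m) (Xs : Set (Fin n)) : Prop :=
  ∃ 𝒞 : Set P.Subgraph,
    (∀ G ∈ 𝒞, G.IsGeneralizedStem ∨ G.IsGeneralizedBud) ∧
    (𝒞.Pairwise fun G H => Disjoint G.verts H.verts) ∧
    ∀ j ∈ Xs, ∃ G ∈ 𝒞, Vertex.state j ∈ G.verts

end StructuredSystem

/-! A switched system is controllable if no proper subspace contains the images of all `B i` and is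
invariant under all `A i`: a steerable subspace of maximal dimension cannot grow by prepending one
more mode, and the intersection of all such maximal subspaces has these two properties
(`isControllable_of_forall_submodule`). With the inputs as extra coordinates, it remains to find
weights of the colored edges whose matrices generate everything from the input coordinate vectors
(`exists_generating_weights`).

The cactus gives each state one ingoing edge. Let `p` send a vertex to the tail of that edge, and
fix the inputs; by disjointness, tail and color determine a state. The graph of `p` consists of
cycles and of trees hanging from cycles and inputs. With weight 1 on the tree edges, the inputs
together with the vertices of the cycles generate everything. The cycles are then made superfluous
one at a time. Reachability provides an edge from a reached vertex `x` to an unreached vertex `h`.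
If `h` is on no unprocessed cycle, the edge is added with a small weight, since generation is an
open condition.

If `h` is on an unprocessed cycle `C`, the edge gets weight 1 and the edges of `C` get a large
weight `s` (`Generates.eventually_close_cycle`). As `s → ∞`, the limit of invariant subspaces is
invariant under the cycle edges alone; these carry a vector entering at `h` around `C`, so the limit
contains all coordinate vectors of `C`. Correcting selections so that their `C`-coordinates are
exactly right removes the large term and gives back invariance under the old matrices. Hence the
limit is everything, and so are the subspaces for large `s`. Each addition enlarges the reached set,
and once everything is reached no cycle is left. -/

/-! ### Limits of families of subspaces -/

section Limits

variable {X : Type*}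

/-- The limits of convergent selections of a one-parameter family of subspaces. -/
def limitSubmodule (V : ℝ → Submodule ℝ (X → ℝ)) : Submodule ℝ (X → ℝ) where
  carrier := {v | ∃ g : ℝ → X → ℝ, (∀ᶠ s in atTop, g s ∈ V s) ∧ Tendsto g atTop (𝓝 v)}
  zero_mem' := ⟨fun _ => 0, .of_forall fun s => (V s).zero_mem, tendsto_const_nhds⟩
  add_mem' := by
    rintro a b ⟨f, hf, hfa⟩ ⟨g, hg, hgb⟩
    exact ⟨fun s => f s + g s, by filter_upwards [hf, hg] with s h₁ h₂ using (V s).add_mem h₁ h₂,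
      hfa.add hgb⟩
  smul_mem' := by
    rintro r a ⟨f, hf, hfa⟩
    exact ⟨fun s => r • f s, by filter_upwards [hf] with s h using (V s).smul_mem r h,
      hfa.const_smul r⟩

theorem mem_limitSubmodule_of_forall {V : ℝ → Submodule ℝ (X → ℝ)} {v : X → ℝ}
    (h : ∀ᶠ s in atTop, v ∈ V s) : v ∈ limitSubmodule V :=
  ⟨fun _ => v, h, tendsto_const_nhds⟩

variable [DecidableEq X]

/-- Coordinate vectors that are limits of a family of subspaces can be approximated by selections
whose relevant coordinates are exact. -/
theorem exists_selection_dual [Finite X] {V : ℝ → Submodule ℝ (X → ℝ)} {C : Set X}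
    (hC : ∀ c ∈ C, Pi.single c 1 ∈ limitSubmodule V) :
    ∃ G : C → ℝ → X → ℝ, (∀ c, Tendsto (G c) atTop (𝓝 (Pi.single c.1 1))) ∧
      ∀ᶠ s in atTop, ∀ c, G c s ∈ V s ∧ ∀ c' : C, G c s c' = if c' = c then 1 else 0 := by
  classical
  have := Fintype.ofFinite X
  choose g hgV hg using fun c : C => hC c.1 c.2
  -- The `C`-coordinates of the selections form a matrix tending to the identity; multiplying by its
  -- inverse makes them exact without changing the limits.
  let M : ℝ → Matrix C C ℝ := fun s c c' => g c s c'
  have hM : Tendsto M atTop (𝓝 1) := by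
    refine tendsto_pi_nhds.2 fun c => tendsto_pi_nhds.2 fun c' => ?_
    have := (tendsto_pi_nhds.1 (hg c)) c'
    rw [Pi.single_apply] at this
    simpa [M, Matrix.one_apply, Subtype.ext_iff, eq_comm] using this
  have hinv : Tendsto (fun s => (M s)⁻¹) atTop (𝓝 1) := by
    have h1 : ContinuousAt Ring.inverse (1 : Matrix C C ℝ).det := by
      rw [Matrix.det_one]
      exact NormedRing.inverse_continuousAt (1 : ℝˣ)
    have := (continuousAt_matrix_inv (1 : Matrix C C ℝ) h1).tendsto.comp hM
    rw [inv_one] at this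
    exact this
  have hdet : ∀ᶠ s in atTop, (M s).det ≠ 0 := by
    have h1 : Tendsto (fun s => (M s).det) atTop (𝓝 (1 : Matrix C C ℝ).det) :=
      ((continuous_id.matrix_det).tendsto _).comp hM
    exact h1.eventually_ne (by simp)
  refine ⟨fun c s => ∑ c', (M s)⁻¹ c c' • g c' s, fun c => ?_, ?_⟩
  · have h1 : Tendsto (fun s => ∑ c', (M s)⁻¹ c c' • g c' s) atTop
        (𝓝 (∑ c', (1 : Matrix C C ℝ) c c' • (Pi.single c'.1 1 : X → ℝ))) :=
      tendsto_finsetSum _ fun c' _ =>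
        ((tendsto_pi_nhds.1 ((tendsto_pi_nhds.1 hinv) c)) c').smul (hg c')
    simpa [Matrix.one_apply] using h1
  · filter_upwards [hdet, eventually_all.2 hgV] with s hs hV c
    refine ⟨(V s).sum_mem fun c' _ => (V s).smul_mem _ (hV c'), fun c' => ?_⟩
    have h1 : ((M s)⁻¹ * M s) c c' = (1 : Matrix C C ℝ) c c' := by
      rw [Matrix.nonsing_inv_mul _ (isUnit_iff_ne_zero.2 hs)]
    rw [Matrix.mul_apply, Matrix.one_apply] at h1
    simpa [M, eq_comm] using h1

theorem Submodule.eq_top_of_single_mem [Finite X] {V : Submodule ℝ (X → ℝ)}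
    (h : ∀ x, Pi.single x 1 ∈ V) : V = ⊤ := by
  have := Fintype.ofFinite X
  refine eq_top_iff.2 fun v _ => ?_
  rw [pi_eq_sum_univ' v]
  exact V.sum_mem fun x _ => V.smul_mem _ (h x)

theorem eventually_eq_top_of_limitSubmodule [Finite X] {V : ℝ → Submodule ℝ (X → ℝ)}
    (h : limitSubmodule V = ⊤) : ∀ᶠ s in atTop, V s = ⊤ := by
  obtain ⟨G, -, hG⟩ := exists_selection_dual (V := V) (C := Set.univ) (by simp [h])
  filter_upwards [hG] with s hs
  refine Submodule.eq_top_of_single_mem fun x => ?_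
  have h1 : G ⟨x, Set.mem_univ x⟩ s = Pi.single x 1 := by
    funext y
    simpa [Pi.single_apply] using (hs ⟨x, Set.mem_univ x⟩).2 ⟨y, Set.mem_univ y⟩
  exact h1 ▸ (hs ⟨x, Set.mem_univ x⟩).1

end Limits

/-! ### Generation by words and reachability -/

section Generation

variable {X ι : Type*} [Fintype X] [DecidableEq X]

/-- The only subspace that contains the coordinate vectors of `J` and is invariant under all the
matrices `K i` is the whole space. -/
def Generates (K : ι → Matrix X X ℝ) (J : Set X) : Prop :=
  ∀ V : Submodule ℝ (X → ℝ), (∀ u ∈ J, Pi.single u 1 ∈ V) →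
    (∀ i, ∀ v ∈ V, (K i).mulVec v ∈ V) → V = ⊤

/-- The images of the coordinate vectors of `I` under products of the matrices `K i`. -/
inductive WordVector (K : ι → Matrix X X ℝ) (I : Set X) : (X → ℝ) → Prop
  | base (u : X) (hu : u ∈ I) : WordVector K I (Pi.single u 1)
  | step (i : ι) (v : X → ℝ) (hv : WordVector K I v) : WordVector K I ((K i).mulVec v)

/-- The vertices that are reached from `I` along nonzero entries of the matrices `K i`. -/
inductive Reached (K : ι → Matrix X X ℝ) (I : Set X) : X → Prop
  | base (u : X) (hu : u ∈ I) : Reached K I u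
  | step (i : ι) (v w : X) (hv : Reached K I v) (hw : K i w v ≠ 0) : Reached K I w

variable {K : ι → Matrix X X ℝ} {I : Set X}

omit [Fintype X] [DecidableEq X] in
theorem Reached.mono {K' : ι → Matrix X X ℝ} (h : ∀ i w v, K i w v ≠ 0 → K' i w v ≠ 0) {v : X}
    (hv : Reached K I v) : Reached K' I v := by
  induction hv with
  | base u hu => exact .base u hu
  | step i v w _ hw ih => exact .step i v w ih (h _ _ _ hw)

theorem WordVector.mem {v : X → ℝ} (hv : WordVector K I v) {V : Submodule ℝ (X → ℝ)}
    (hI : ∀ u ∈ I, Pi.single u 1 ∈ V) (hK : ∀ i, ∀ v ∈ V, (K i).mulVec v ∈ V) : v ∈ V := by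
  induction hv with
  | base u hu => exact hI u hu
  | step i v _ ih => exact hK i v ih

theorem WordVector.nonneg (hK : ∀ i w v, 0 ≤ K i w v) {v : X → ℝ} (hv : WordVector K I v) (x : X) :
    0 ≤ v x := by
  induction hv generalizing x with
  | base u hu => rw [Pi.single_apply]; split_ifs <;> norm_num
  | step i v _ ih => exact Finset.sum_nonneg fun y _ => mul_nonneg (hK _ _ _) (ih y)

theorem WordVector.eq_zero {v : X → ℝ} (hv : WordVector K I v) {c : X} (hc : c ∉ I)
    (hK : ∀ i w, K i c w = 0) : v c = 0 := by
  cases hv with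
  | base u hu => exact Pi.single_eq_of_ne (by rintro rfl; exact hc hu) _
  | step i v _ => simp [Matrix.mulVec, dotProduct, hK]

/-- Nonnegative entries exclude cancellation, so following a path to `x` gives a word that is
positive there. -/
theorem Reached.exists_wordVector (hK : ∀ i w v, 0 ≤ K i w v) {x : X} (hx : Reached K I x) :
    ∃ v, WordVector K I v ∧ v x ≠ 0 := by
  induction hx with
  | base u hu => exact ⟨_, .base u hu, by simp⟩
  | step i x y _ hy ih =>
    obtain ⟨v, hv, hvx⟩ := ih
    refine ⟨_, .step i v hv, ne_of_gt ?_⟩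
    have h0 : ∀ z, 0 ≤ K i y z * v z := fun z => mul_nonneg (hK _ _ _) (hv.nonneg hK z)
    exact Finset.sum_pos' (fun z _ => h0 z)
      ⟨x, Finset.mem_univ _, (h0 x).lt_of_ne' (mul_ne_zero hy hvx)⟩

/-- If the matrices of a family act as `K` on the word vectors that vanish at `x`, then some word
vector of `K` which does not vanish at `x` is a word vector of the whole family. -/
theorem WordVector.exists_common {σ : Type*} {K' : σ → ι → Matrix X X ℝ} {x : X}
    (h : ∀ s i v, WordVector K I v → v x = 0 → (K' s i).mulVec v = (K i).mulVec v) {v : X → ℝ}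
    (hv : WordVector K I v) (hvx : v x ≠ 0) :
    ∃ v', WordVector K I v' ∧ (∀ s, WordVector (K' s) I v') ∧ v' x ≠ 0 := by
  -- The word is built letter by letter, stopping at the first vector that is nonzero at `x`; up to
  -- there the families agree.
  have key : (∀ s, WordVector (K' s) I v) ∨
      ∃ v', WordVector K I v' ∧ (∀ s, WordVector (K' s) I v') ∧ v' x ≠ 0 := by
    clear hvx
    induction hv with
    | base u hu => exact .inl fun s => .base u hu
    | step i v hv ih =>
      rcases ih with ih | ih
      · by_cases hvx : v x = 0
        · exact .inl fun s => h s i v hv hvx ▸ .step i v (ih s)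
        · exact .inr ⟨v, hv, ih, hvx⟩
      · exact .inr ih
  exact key.elim (fun h => ⟨v, hv, h, hvx⟩) id

end Generation

/-! ### Generation under small and large perturbations -/

section Perturbation

variable {X ι : Type*} [Fintype X] [DecidableEq X]

/-- Choosing a counterexample whenever generation fails leaves a single subspace to test, so that a
family of matrices yields a family of subspaces with a limit. -/
theorem exists_invariant_submodule (K : ι → Matrix X X ℝ) (J : Set X) :
    ∃ V : Submodule ℝ (X → ℝ), (∀ u ∈ J, Pi.single u 1 ∈ V) ∧
      (∀ i, ∀ v ∈ V, (K i).mulVec v ∈ V) ∧ (V = ⊤ → Generates K J) := by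
  by_cases h : Generates K J
  · exact ⟨⊤, by simp, by simp, fun _ => h⟩
  · simp only [Generates, not_forall] at h
    obtain ⟨V, h1, h2, h3⟩ := h
    exact ⟨V, h1, h2, fun h => absurd h h3⟩

omit [DecidableEq X] in
theorem tendsto_mulVec {A : ℝ → Matrix X X ℝ} {A₀ : Matrix X X ℝ} {g : ℝ → X → ℝ} {v : X → ℝ}
    (hA : Tendsto A atTop (𝓝 A₀)) (hg : Tendsto g atTop (𝓝 v)) :
    Tendsto (fun s => (A s).mulVec (g s)) atTop (𝓝 (A₀.mulVec v)) :=
  ((continuous_fst.matrix_mulVec continuous_snd).tendsto (A₀, v)).comp (hA.prodMk_nhds hg)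

/-- Generation is an open condition: a limit of invariant subspaces is invariant under the limit
matrices, hence is everything. -/
theorem Generates.eventually_of_tendsto {K : ι → Matrix X X ℝ} {K' : ℝ → ι → Matrix X X ℝ}
    {J : Set X} (h : Generates K J) (hK' : ∀ i, Tendsto (fun s => K' s i) atTop (𝓝 (K i))) :
    ∀ᶠ s in atTop, Generates (K' s) J := by
  choose V hJ hV hgen using fun s => exists_invariant_submodule (K' s) J
  have hL : limitSubmodule V = ⊤ := by
    refine h _ (fun u hu => mem_limitSubmodule_of_forall (.of_forall fun s => hJ s u hu)) ?_
    rintro i v ⟨g, hg, hgv⟩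
    exact ⟨fun s => (K' s i).mulVec (g s), by filter_upwards [hg] with s hs using hV s i _ hs,
      tendsto_mulVec (hK' i) hgv⟩
  filter_upwards [eventually_eq_top_of_limitSubmodule hL] with s hs using hgen s hs

open Classical in
/-- The matrices of the edges from `p w` to `w` of color `col w`, for `w ∈ C`. -/
noncomputable def matchingMatrix (C : Set X) (p : X → X) (col : X → ι) (i : ι) : Matrix X X ℝ :=
  .of fun w v => if w ∈ C ∧ v = p w ∧ col w = i then 1 else 0

open Classical in
/-- The matrices of a single edge from `x` to `h` of color `r`. -/
noncomputable def edgeMatrix (r : ι) (x h : X) (i : ι) : Matrix X X ℝ :=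
  .of fun w v => if w = h ∧ v = x ∧ i = r then 1 else 0

open Classical in
theorem matchingMatrix_mulVec (C : Set X) (p : X → X) (col : X → ι) (i : ι) (v : X → ℝ) (w : X) :
    (matchingMatrix C p col i).mulVec v w = if w ∈ C ∧ col w = i then v (p w) else 0 := by
  simp only [matchingMatrix, Matrix.mulVec, dotProduct, Matrix.of_apply]
  split_ifs with h
  · simp [h.1, h.2]
  · exact Finset.sum_eq_zero fun y _ => by rw [if_neg (by tauto), zero_mul]

open Classical in
theorem edgeMatrix_mulVec (r : ι) (x h : X) (i : ι) (v : X → ℝ) :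
    (edgeMatrix r x h i).mulVec v = (if i = r then v x else 0) • (Pi.single h 1 : X → ℝ) := by
  funext w
  simp only [edgeMatrix, Matrix.mulVec, dotProduct, Matrix.of_apply, Pi.smul_apply, smul_eq_mul,
    Pi.single_apply, ite_mul, one_mul, zero_mul, mul_ite, mul_one, mul_zero]
  by_cases hw : w = h <;> by_cases hi : i = r <;> simp [hw, hi]

/-- Among the edges into `C`, only the one into `c` has tail `p c` and color `col c`; the matrix
sees `z` only at tails, so nothing else survives. -/
theorem matchingMatrix_mulVec_single {C : Set X} {p : X → X} {col : X → ι}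
    (hinj : ∀ c ∈ C, ∀ c' ∈ C, p c = p c' → col c = col c' → c = c') {c : X} (hc : c ∈ C)
    {z : X → ℝ} {κ : ℝ} (hz : ∀ w ∈ C, z (p w) = if p w = p c then κ else 0) :
    (matchingMatrix C p col (col c)).mulVec z = κ • Pi.single c 1 := by
  classical
  funext w
  rw [matchingMatrix_mulVec, Pi.smul_apply, Pi.single_apply, smul_eq_mul]
  by_cases hw : w = c
  · subst hw; simp [hc, hz w hc]
  · rw [if_neg hw, mul_zero]
    split_ifs with h
    · rw [hz w h.1, if_neg fun h' => hw (hinj w h.1 c hc h' h.2)]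
    · rfl

omit [DecidableEq X] in
/-- A limit of subspaces that are invariant under `A + s N` for `s → ∞` is invariant
under `N`. -/
theorem limitSubmodule_mulVec_leading {V : ℝ → Submodule ℝ (X → ℝ)} {A N : Matrix X X ℝ}
    (hV : ∀ s, ∀ v ∈ V s, (A + s • N).mulVec v ∈ V s) {v : X → ℝ} (hv : v ∈ limitSubmodule V) :
    N.mulVec v ∈ limitSubmodule V := by
  obtain ⟨g, hg, hgv⟩ := hv
  -- Dividing by `s` turns `A + s • N` into a matrix that tends to `N`.
  refine ⟨fun s => s⁻¹ • (A + s • N).mulVec (g s), ?_, ?_⟩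
  · filter_upwards [hg] with s hs using (V s).smul_mem _ (hV s _ hs)
  · have h1 : Tendsto (fun s : ℝ => (s⁻¹ • A + N).mulVec (g s)) atTop
        (𝓝 (((0 : ℝ) • A + N).mulVec v)) :=
      tendsto_mulVec ((tendsto_inv_atTop_zero.smul_const A).add_const N) hgv
    rw [zero_smul, zero_add] at h1
    refine h1.congr' ?_
    filter_upwards [eventually_ne_atTop 0] with s hs
    rw [← Matrix.smul_mulVec, smul_add, smul_smul, inv_mul_cancel₀ hs, one_smul]

/-- Closing a cycle: if `C` is a cycle of `p` on which the matrices `K i` have zero rows, the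
coordinate vectors of `C` can be replaced, in a generating set, by an edge from a reached vertex
to `C` together with the edges of the cycle, with large weights. -/
theorem Generates.eventually_close_cycle {K : ι → Matrix X X ℝ} {I U C : Set X} {p : X → X}
    {col : X → ι} {r : ι} {x h : X} (hgen : Generates K (I ∪ U)) (hCI : ∀ c ∈ C, c ∉ I)
    (hrow : ∀ c ∈ C, ∀ i v, K i c v = 0) (hKp : ∀ c ∈ C, ∀ w, K (col c) w (p c) = 0)
    (hinj : ∀ c ∈ C, ∀ c' ∈ C, p c = p c' → col c = col c' → c = c')
    (hCp : ∀ c ∈ C, p c ∈ C) (hh : h ∈ C) (horb : ∀ c ∈ C, ∃ k, p^[k] h = c)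
    (hper : h ∈ Function.periodicPts p) (hK : ∀ i w v, 0 ≤ K i w v) (hx : Reached K I x) :
    ∀ᶠ s : ℝ in atTop, Generates
      (fun i => K i + edgeMatrix r x h i + s • matchingMatrix C p col i) (I ∪ U \ C) := by
  classical
  set N := matchingMatrix C p col with hN
  set F := edgeMatrix r x h with hF
  choose V hJ hV hgenV using fun s : ℝ =>
    exists_invariant_submodule (fun i => K i + F i + s • N i) (I ∪ U \ C)
  suffices hL : limitSubmodule V = ⊤ by
    filter_upwards [eventually_eq_top_of_limitSubmodule hL] with s hs using hgenV s hs
  have hNL : ∀ i, ∀ v ∈ limitSubmodule V, (N i).mulVec v ∈ limitSubmodule V := fun i v hv =>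
    limitSubmodule_mulVec_leading (fun s => hV s i) hv
  have hN0 : ∀ i v, (∀ c ∈ C, v c = 0) → (N i).mulVec v = 0 := by
    intro i v hv
    funext w
    rw [matchingMatrix_mulVec]
    split_ifs with h
    · exact hv _ (hCp w h.1)
    · rfl
  have hword : ∀ v, WordVector K I v → ∀ c ∈ C, v c = 0 := fun v hv c hc =>
    hv.eq_zero (hCI c hc) (hrow c hc)
  -- a constant vector of the family whose `C`-part is concentrated at `h`
  obtain ⟨z, κ, hκ, hzL, hz⟩ : ∃ (z : X → ℝ) (κ : ℝ), κ ≠ 0 ∧ z ∈ limitSubmodule V ∧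
      ∀ c ∈ C, z c = if c = h then κ else 0 := by
    obtain ⟨v₀, hv₀, hv₀x⟩ := hx.exists_wordVector hK
    -- Words of `K` vanish on `C`, so the large term does not act on them, and the new edge stays
    -- silent until a word is nonzero at `x`. One further letter `r` then puts `v x` at `h`,
    -- independently of `s`.
    obtain ⟨v, hv, hv', hvx⟩ := hv₀.exists_common
      (K' := fun (s : ℝ) i => K i + F i + s • N i) (x := x) (fun s i v hv hvx => by
        rw [Matrix.add_mulVec, Matrix.add_mulVec, Matrix.smul_mulVec, hN0 i v (hword v hv),
          edgeMatrix_mulVec, hvx]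
        simp) hv₀x
    refine ⟨(K r).mulVec v + v x • Pi.single h 1, v x, hvx,
      mem_limitSubmodule_of_forall (.of_forall fun s => ?_), fun c hc => ?_⟩
    · have h1 := hV s r v ((hv' s).mem (fun u hu => hJ s u (.inl hu)) (hV s))
      rw [Matrix.add_mulVec, Matrix.add_mulVec, Matrix.smul_mulVec, hN0 r v (hword v hv),
          edgeMatrix_mulVec] at h1
      simpa using h1
    · have h1 := hword _ (hv.step r) c hc
      simp [h1, Pi.single_apply]
  have hback : ∀ c ∈ C, Pi.single (p c) 1 ∈ limitSubmodule V →
      Pi.single c 1 ∈ limitSubmodule V := by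
    intro c hc hpc
    have h1 := hNL (col c) _ hpc
    rwa [matchingMatrix_mulVec_single hinj hc (κ := 1)
      (fun w _ => by rw [Pi.single_apply]), one_smul] at h1
  have hit : ∀ k, p^[k] h ∈ C := fun k => by
    induction k with
    | zero => exact hh
    | succ k ih => rw [Function.iterate_succ_apply']; exact hCp _ ih
  obtain ⟨l, hl, hlh⟩ := hper
  have hCL : ∀ c ∈ C, Pi.single c 1 ∈ limitSubmodule V := by
    -- The edges run against `p`: from `h` the first edge leads to `p^[l - 1] h`, and each further
    -- edge lowers the exponent by one.
    have h1 : ∀ k < l, Pi.single (p^[l - 1 - k] h) 1 ∈ limitSubmodule V := by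
      intro k hk
      induction k with
      | zero =>
        have hpc : p (p^[l - 1] h) = h := by
          rw [← Function.iterate_succ_apply' p, Nat.succ_eq_add_one, Nat.sub_add_cancel hl]
          exact hlh
        have h1 := hNL (col (p^[l - 1] h)) z hzL
        rw [matchingMatrix_mulVec_single hinj (hit _) (κ := κ)
          (fun w hw => by rw [hz _ (hCp w hw), hpc])] at h1
        have := (limitSubmodule V).smul_mem κ⁻¹ h1
        rwa [smul_smul, inv_mul_cancel₀ hκ, one_smul] at this
      | succ k ih =>
        refine hback _ (hit _) ?_
        rw [← Function.iterate_succ_apply' p]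
        convert ih (by omega) using 3
        omega
    intro c hc
    obtain ⟨k, rfl⟩ := horb c hc
    rw [← hlh.iterate_mod_apply k]
    have := Nat.mod_lt k hl
    convert h1 (l - 1 - k % l) (by omega) using 3
    omega
  obtain ⟨G, hG, hGV⟩ := exists_selection_dual hCL
  have hFL : ∀ i v, (F i).mulVec v ∈ limitSubmodule V := fun i v => by
    rw [edgeMatrix_mulVec]
    exact (limitSubmodule V).smul_mem _ (hCL h hh)
  -- invariance under `K i`, up to multiples of `e_h`, for selections on which `N i` vanishes
  have hinv : ∀ i v (g : ℝ → X → ℝ), (∀ᶠ s in atTop, g s ∈ V s) → Tendsto g atTop (𝓝 v) →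
      (∀ᶠ s in atTop, (N i).mulVec (g s) = 0) → (K i).mulVec v ∈ limitSubmodule V := by
    intro i v g hg hgv hg0
    have h1 : (K i + F i).mulVec v ∈ limitSubmodule V := by
      refine ⟨fun s => (K i + F i).mulVec (g s), ?_, tendsto_mulVec tendsto_const_nhds hgv⟩
      filter_upwards [hg, hg0] with s hs h0
      have := hV s i _ hs
      rwa [Matrix.add_mulVec, Matrix.smul_mulVec, h0, smul_zero, add_zero] at this
    rw [Matrix.add_mulVec] at h1
    exact (Submodule.add_mem_iff_left _ (hFL i v)).1 h1
  have hKC : ∀ i, ∀ c : C, (K i).mulVec (Pi.single c.1 1) ∈ limitSubmodule V := by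
    intro i c
    -- If a cycle edge of color `i` leaves `c`, that column of `K i` is zero. Otherwise `N i` reads
    -- only coordinates in `C` other than `c`, where `G c s` vanishes exactly.
    by_cases hi : ∃ c' ∈ C, p c' = c ∧ col c' = i
    · obtain ⟨c', hc', hpc, rfl⟩ := hi
      convert (limitSubmodule V).zero_mem
      funext w
      simpa [← hpc] using hKp c' hc' w
    · refine hinv i _ (G c) (hGV.mono fun s hs => (hs c).1) (hG c) (hGV.mono fun s hs => ?_)
      funext w
      rw [matchingMatrix_mulVec]
      split_ifs with hw
      · rw [(hs c).2 ⟨p w, hCp w hw.1⟩, if_neg, Pi.zero_apply]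
        exact fun h' => hi ⟨w, hw.1, congrArg Subtype.val h', hw.2⟩
      · rfl
  refine hgen _ ?_ ?_
  · rintro u (hu | hu)
    · exact mem_limitSubmodule_of_forall (.of_forall fun s => hJ s u (.inl hu))
    · by_cases hc : u ∈ C
      · exact hCL u hc
      · exact mem_limitSubmodule_of_forall (.of_forall fun s => hJ s u (.inr ⟨hu, hc⟩))
  · rintro i v ⟨g, hg, hgv⟩
    -- Subtracting these selections makes all `C`-coordinates exactly zero, not only in the limit,
    -- so the unbounded factor `s` does no harm.
    have hdec : (K i).mulVec (v - ∑ c : C, v c • (Pi.single c.1 1 : X → ℝ)) ∈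
        limitSubmodule V := by
      refine hinv i _ (fun s => g s - ∑ c : C, g s c • G c s) ?_ ?_ ?_
      · filter_upwards [hg, hGV] with s hs hGs
        exact (V s).sub_mem hs ((V s).sum_mem fun c _ => (V s).smul_mem _ (hGs c).1)
      · exact hgv.sub (tendsto_finsetSum _ fun c _ => ((tendsto_pi_nhds.1 hgv) c).smul (hG c))
      · filter_upwards [hGV] with s hGs
        refine hN0 i _ fun c hc => ?_
        have h1 : ∀ c' : C, G c' s c = if (⟨c, hc⟩ : C) = c' then 1 else 0 := fun c' =>
          (hGs c').2 ⟨c, hc⟩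
        simp [h1]
    rw [Matrix.mulVec_sub] at hdec
    refine (Submodule.sub_mem_iff_left _ ?_).1 hdec
    rw [← Matrix.mulVecLin_apply, map_sum]
    refine Submodule.sum_mem _ fun c _ => ?_
    rw [map_smul, Matrix.mulVecLin_apply]
    exact Submodule.smul_mem _ _ (hKC i c)

end Perturbation

/-! ### Induction on the set of unreached vertices -/

section Weights

variable {X ι : Type*}

theorem exists_iterate_mem_periodicPts [Finite X] (f : X → X) (x : X) :
    ∃ k, f^[k] x ∈ Function.periodicPts f := by
  obtain ⟨a, b, hab, h⟩ := Finite.exists_ne_map_eq_of_infinite fun k => f^[k] x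
  wlog hlt : a < b generalizing a b
  · exact this b a hab.symm h.symm (lt_of_le_of_ne (not_lt.1 hlt) hab.symm)
  refine ⟨a, Function.mk_mem_periodicPts (n := b - a) (by omega) ?_⟩
  rw [Function.IsPeriodicPt, Function.IsFixedPt, ← Function.iterate_add_apply,
    Nat.sub_add_cancel hlt.le]
  exact h.symm

theorem exists_step_of_reflTransGen {r : X → X → Prop} {S : Set X} {u v : X}
    (h : Relation.ReflTransGen r u v) (hu : u ∈ S) (hv : v ∉ S) :
    ∃ x y, x ∈ S ∧ y ∉ S ∧ r x y := by
  induction h with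
  | refl => exact absurd hu hv
  | @tail b c _ hbc ih =>
    by_cases hb : b ∈ S
    · exact ⟨b, c, hb, hv, hbc⟩
    · exact ih hb

variable [Fintype X] [DecidableEq X]

omit [Fintype X] [DecidableEq X] in
theorem not_reached_of_row_eq_zero {K : ι → Matrix X X ℝ} {I : Set X} {c : X} (hc : c ∉ I)
    (hrow : ∀ i v, K i c v = 0) : ¬ Reached K I c := by
  rintro (⟨_, hu⟩ | ⟨i, v, _, _, hw⟩)
  · exact hc hu
  · exact hw (hrow i v)

omit [Fintype X] in
theorem edgeMatrix_apply_of_ne {r : ι} {x h w v : X} {i : ι} (hwv : w ≠ h ∨ v ≠ x) :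
    edgeMatrix r x h i w v = 0 :=
  if_neg (by tauto)

omit [Fintype X] in
theorem edgeMatrix_nonneg (r : ι) (x h w v : X) (i : ι) : 0 ≤ edgeMatrix r x h i w v := by
  rw [edgeMatrix, Matrix.of_apply]
  split_ifs <;> norm_num

omit [Fintype X] in
theorem matchingMatrix_nonneg (C : Set X) (p : X → X) (col : X → ι) (i : ι) (w v : X) :
    0 ≤ matchingMatrix C p col i w v := by
  rw [matchingMatrix, Matrix.of_apply]
  split_ifs <;> norm_num

omit [Fintype X] in
theorem edge_of_edgeMatrix_ne_zero {r : ι} {x h w v : X} {i : ι}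
    (hwv : edgeMatrix r x h i w v ≠ 0) : w = h ∧ v = x ∧ i = r := by
  by_contra hn
  exact hwv (if_neg hn)

omit [Fintype X] in
theorem matching_of_matchingMatrix_ne_zero {C : Set X} {p : X → X} {col : X → ι} {i : ι} {w v : X}
    (hwv : matchingMatrix C p col i w v ≠ 0) : w ∈ C ∧ v = p w ∧ col w = i := by
  by_contra hn
  exact hwv (if_neg hn)

/-- The matrices `K` are weights on the edges `E` which generate everything from `I` and from the
vertices of the unprocessed cycles `U` of `p`. -/
structure IsPartialWeights (E : ι → X → X → Prop) (I : Set X) (p : X → X) (col : X → ι)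
    (K : ι → Matrix X X ℝ) (U : Set X) : Prop where
  nonneg : ∀ i w v, 0 ≤ K i w v
  edge : ∀ i w v, K i w v ≠ 0 → E i v w
  generates : Generates K (I ∪ U)
  notMem : ∀ c ∈ U, c ∉ I
  periodic : U ⊆ Function.periodicPts p
  closed : ∀ c ∈ U, p c ∈ U
  row : ∀ c ∈ U, ∀ i v, K i c v = 0
  col_eq_zero : ∀ c ∈ U, ∀ w, K (col c) w (p c) = 0

variable {E : ι → X → X → Prop} {I : Set X} {p : X → X} {col : X → ι}

/-- Iterating `p` leads from any vertex to a periodic point; the tree edges carry coordinate vectors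
back from there or from an input. -/
theorem isPartialWeights_matchingMatrix (hpI : ∀ v ∈ I, p v = v)
    (hE : ∀ v, v ∉ I → E (col v) (p v) v)
    (hinj : ∀ v, v ∉ I → ∀ w, w ∉ I → p v = p w → col v = col w → v = w) :
    IsPartialWeights E I p col (matchingMatrix (I ∪ Function.periodicPts p)ᶜ p col)
      (Function.periodicPts p \ I) where
  nonneg i := matchingMatrix_nonneg _ _ _ i
  edge i w v h := by
    obtain ⟨hw, rfl, rfl⟩ := matching_of_matchingMatrix_ne_zero h
    exact hE w fun h => hw (.inl h)
  generates V hV hinv := by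
    refine Submodule.eq_top_of_single_mem fun x => ?_
    obtain ⟨k, hk⟩ := exists_iterate_mem_periodicPts p x
    induction k generalizing x with
    | zero =>
      by_cases hx : x ∈ I
      · exact hV x (.inl hx)
      · exact hV x (.inr ⟨hk, hx⟩)
    | succ k ih =>
      by_cases hx : x ∈ I
      · exact hV x (.inl hx)
      by_cases hx' : x ∈ Function.periodicPts p
      · exact hV x (.inr ⟨hx', hx⟩)
      have h1 := hinv (col x) _ (ih (p x) hk)
      rwa [matchingMatrix_mulVec_single (C := (I ∪ Function.periodicPts p)ᶜ) (κ := 1) (c := x)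
        (fun c hc c' hc' => hinj c (fun h => hc (.inl h)) c' (fun h => hc' (.inl h)))
        (by simp [hx, hx']) (fun w _ => by rw [Pi.single_apply]), one_smul] at h1
  notMem c hc := hc.2
  periodic := Set.sdiff_subset
  closed c hc := by
    obtain ⟨⟨l, hl, hlc⟩, hcI⟩ := hc
    refine ⟨⟨l, hl, hlc.map (Function.Commute.refl p)⟩, fun h => hcI ?_⟩
    have h1 : p^[l - 1] (p c) = c := by
      rw [← Function.iterate_succ_apply, Nat.succ_eq_add_one, Nat.sub_add_cancel hl]
      exact hlc
    rw [Function.iterate_fixed (hpI _ h)] at h1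
    rwa [h1] at h
  row c hc i v := by
    by_contra h
    exact (matching_of_matchingMatrix_ne_zero h).1 (.inr hc.1)
  col_eq_zero c hc w := by
    by_contra h
    obtain ⟨hw, hp, hcol⟩ := matching_of_matchingMatrix_ne_zero h
    have := hinj c hc.2 w (fun h => hw (.inl h)) hp hcol.symm
    exact hw (.inr (this ▸ hc.1))

/-- A small weight preserves generation. Vertices of `U` have zero rows and so are unreached, which
is why an edge leaving the reached vertex `x` respects the column condition. -/
theorem IsPartialWeights.exists_add_edge {K : ι → Matrix X X ℝ} {U : Set X}
    (hK : IsPartialWeights E I p col K U) {r : ι} {x h : X} (hr : E r x h) (hx : Reached K I x)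
    (hhU : h ∉ U) :
    ∃ K', IsPartialWeights E I p col K' U ∧ (∀ i w v, K i w v ≠ 0 → K' i w v ≠ 0) ∧
      K' r h x ≠ 0 := by
  have hlim : ∀ i, Tendsto (fun s : ℝ => K i + s⁻¹ • edgeMatrix r x h i) atTop (𝓝 (K i)) := by
    intro i
    simpa using ((tendsto_inv_atTop_zero (𝕜 := ℝ)).smul_const (edgeMatrix r x h i)).const_add (K i)
  obtain ⟨s, hgen, hs⟩ :=
    ((hK.generates.eventually_of_tendsto hlim).and (eventually_gt_atTop 0)).exists
  have hs' : 0 < s⁻¹ := inv_pos.2 hs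
  have hF : ∀ i w v, 0 ≤ s⁻¹ * edgeMatrix r x h i w v := fun i w v =>
    mul_nonneg hs'.le (edgeMatrix_nonneg ..)
  refine ⟨_, ⟨fun i w v => add_nonneg (hK.nonneg i w v) (hF i w v), fun i w v hne => ?_, hgen,
    hK.notMem, hK.periodic, hK.closed, fun c hc i v => ?_, fun c hc w => ?_⟩, fun i w v hne => ?_,
    ?_⟩
  · by_cases h0 : K i w v = 0
    · have : edgeMatrix r x h i w v ≠ 0 := fun h1 => hne (by simp [h0, h1])
      obtain ⟨rfl, rfl, rfl⟩ := edge_of_edgeMatrix_ne_zero this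
      exact hr
    · exact hK.edge i w v h0
  · have hne : c ≠ h := by rintro rfl; exact hhU hc
    simp [hK.row c hc, edgeMatrix_apply_of_ne (.inl hne)]
  · have hne : p c ≠ x := by
      rintro rfl
      exact not_reached_of_row_eq_zero (hK.notMem _ (hK.closed c hc)) (hK.row _ (hK.closed c hc)) hx
    simp [hK.col_eq_zero c hc, edgeMatrix_apply_of_ne (.inr hne)]
  · exact (add_pos_of_pos_of_nonneg ((hK.nonneg i w v).lt_of_ne' hne) (hF i w v)).ne'
  · refine (add_pos_of_nonneg_of_pos (hK.nonneg r h x) ?_).ne'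
    simpa [edgeMatrix] using hs

theorem IsPartialWeights.exists_close_cycle {K : ι → Matrix X X ℝ} {U : Set X}
    (hE : ∀ v, v ∉ I → E (col v) (p v) v)
    (hinj : ∀ v, v ∉ I → ∀ w, w ∉ I → p v = p w → col v = col w → v = w)
    (hK : IsPartialWeights E I p col K U) {r : ι} {x h : X} (hr : E r x h) (hx : Reached K I x)
    (hhU : h ∈ U) :
    ∃ K' U', IsPartialWeights E I p col K' U' ∧ (∀ i w v, K i w v ≠ 0 → K' i w v ≠ 0) ∧
      K' r h x ≠ 0 := by
  set C : Set X := {c | ∃ k, p^[k] h = c} with hC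
  have hCU : C ⊆ U := by
    rintro _ ⟨k, rfl⟩
    induction k with
    | zero => exact hhU
    | succ k ih => rw [Function.iterate_succ_apply']; exact hK.closed _ ih
  have hCI : ∀ c ∈ C, c ∉ I := fun c hc => hK.notMem c (hCU hc)
  have hCp : ∀ c ∈ C, p c ∈ C := by
    rintro _ ⟨k, rfl⟩
    exact ⟨k + 1, Function.iterate_succ_apply' p k h⟩
  obtain ⟨s, hgen, hs⟩ := ((hK.generates.eventually_close_cycle (r := r) hCI
    (fun c hc => hK.row c (hCU hc)) (fun c hc => hK.col_eq_zero c (hCU hc))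
    (fun c hc c' hc' => hinj c (hCI c hc) c' (hCI c' hc')) hCp ⟨0, rfl⟩ (fun c hc => hc)
    (hK.periodic hhU) hK.nonneg hx).and (eventually_gt_atTop 0)).exists
  have hF : ∀ i w v, 0 ≤ edgeMatrix r x h i w v := fun i w v => edgeMatrix_nonneg ..
  have hN : ∀ i w v, 0 ≤ s * matchingMatrix C p col i w v := fun i w v =>
    mul_nonneg hs.le (matchingMatrix_nonneg ..)
  refine ⟨_, U \ C, ⟨fun i w v => add_nonneg (add_nonneg (hK.nonneg i w v) (hF i w v)) (hN i w v),
    fun i w v hne => ?_, hgen, fun c hc => hK.notMem c hc.1, fun c hc => hK.periodic hc.1,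
    fun c hc => ⟨hK.closed c hc.1, fun hpc => hc.2 ?_⟩, fun c hc i v => ?_, fun c hc w => ?_⟩,
    fun i w v hne => ?_, ?_⟩
  · by_cases h0 : K i w v = 0
    · by_cases h1 : edgeMatrix r x h i w v = 0
      · have : matchingMatrix C p col i w v ≠ 0 := fun h2 => hne (by simp [h0, h1, h2])
        obtain ⟨hw, rfl, rfl⟩ := matching_of_matchingMatrix_ne_zero this
        exact hE w (hCI w hw)
      · obtain ⟨rfl, rfl, rfl⟩ := edge_of_edgeMatrix_ne_zero h1
        exact hr
    · exact hK.edge i w v h0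
  -- If `p c` is on the orbit of `h`, so is `c`, because `c` is periodic and equals `p^[l - 1] (p
  -- c)`.
  · obtain ⟨k, hk⟩ := hpc
    obtain ⟨l, hl, hlc⟩ := hK.periodic hc.1
    refine ⟨l - 1 + k, ?_⟩
    rw [Function.iterate_add_apply, hk, ← Function.iterate_succ_apply, Nat.succ_eq_add_one,
      Nat.sub_add_cancel hl]
    exact hlc
  · have hne : c ≠ h := by rintro rfl; exact hc.2 ⟨0, rfl⟩
    have h0 : matchingMatrix C p col i c v = 0 := by
      by_contra h0
      exact hc.2 (matching_of_matchingMatrix_ne_zero h0).1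
    simp [hK.row c hc.1, edgeMatrix_apply_of_ne (.inl hne), h0]
  · have hne : p c ≠ x := by
      rintro rfl
      exact not_reached_of_row_eq_zero (hK.notMem _ (hK.closed c hc.1))
        (hK.row _ (hK.closed c hc.1)) hx
    have h0 : matchingMatrix C p col (col c) w (p c) = 0 := by
      by_contra h0
      obtain ⟨hw, hp, hcol⟩ := matching_of_matchingMatrix_ne_zero h0
      exact hc.2 (hinj c (hK.notMem c hc.1) w (hCI w hw) hp hcol.symm ▸ hw)
    simp [hK.col_eq_zero c hc.1, edgeMatrix_apply_of_ne (.inr hne), h0]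
  · exact (add_pos_of_pos_of_nonneg (add_pos_of_pos_of_nonneg
      ((hK.nonneg i w v).lt_of_ne' hne) (hF i w v)) (hN i w v)).ne'
  · refine (add_pos_of_pos_of_nonneg (add_pos_of_nonneg_of_pos (hK.nonneg r h x) ?_)
      (hN r h x)).ne'
    simp [edgeMatrix]

/-- If every vertex is reachable from `I` and the vertices outside `I` have ingoing edges with
pairwise different pairs of a tail and a color, then suitable weights of the edges generate the
whole space from `I`. -/
theorem exists_generating_weights (hpI : ∀ v ∈ I, p v = v)
    (hE : ∀ v, v ∉ I → E (col v) (p v) v)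
    (hinj : ∀ v, v ∉ I → ∀ w, w ∉ I → p v = p w → col v = col w → v = w)
    (hreach : ∀ v, ∃ u ∈ I, Relation.ReflTransGen (fun v w => ∃ i, E i v w) u v) :
    ∃ K : ι → Matrix X X ℝ, (∀ i w v, K i w v ≠ 0 → E i v w) ∧ Generates K I := by
  suffices key : ∀ (n : ℕ) (K : ι → Matrix X X ℝ) (U : Set X), IsPartialWeights E I p col K U →
      {v | ¬ Reached K I v}.ncard = n →
      ∃ K : ι → Matrix X X ℝ, (∀ i w v, K i w v ≠ 0 → E i v w) ∧ Generates K I from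
    key _ _ _ (isPartialWeights_matchingMatrix hpI hE hinj) rfl
  intro n
  induction n using Nat.strong_induction_on with
  | _ n ih =>
    intro K U hK hn
    by_cases hall : ∀ v, Reached K I v
    · have hU : U = ∅ := Set.eq_empty_of_forall_notMem fun c hc =>
        not_reached_of_row_eq_zero (hK.notMem c hc) (hK.row c hc) (hall c)
      have := hK.generates
      rw [hU, Set.union_empty] at this
      exact ⟨K, hK.edge, this⟩
    · push Not at hall
      obtain ⟨v, hv⟩ := hall
      obtain ⟨u, hu, huv⟩ := hreach v
      obtain ⟨x, h, hx, hh, r, hr⟩ := exists_step_of_reflTransGen (S := {v | Reached K I v}) huv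
        (.base u hu) hv
      obtain ⟨K', U', hK', hmono, hne⟩ : ∃ K' U', IsPartialWeights E I p col K' U' ∧
          (∀ i w v, K i w v ≠ 0 → K' i w v ≠ 0) ∧ K' r h x ≠ 0 := by
        by_cases hhU : h ∈ U
        · exact hK.exists_close_cycle hE hinj hr hx hhU
        · obtain ⟨K', h'⟩ := hK.exists_add_edge hr hx hhU
          exact ⟨K', U, h'⟩
      -- Nonzero entries persist, so reached vertices stay reached, and `h` becomes reached.
      refine ih _ ?_ K' U' hK' rfl
      rw [← hn]
      refine Set.ncard_lt_ncard ⟨fun w hw hw' => hw (hw'.mono hmono), fun hsub => ?_⟩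
        (Set.toFinite _)
      exact hsub hh (.step r x h (Reached.mono hmono hx) hne)

end Weights

/-! ### Controllability from invariant subspaces -/

section Control

theorem PiecewiseContinuous.const {E : Type*} [TopologicalSpace E] (c : E) (a b : ℝ) :
    PiecewiseContinuous (fun _ => c) a b :=
  ⟨∅, fun _ _ _ => continuousWithinAt_const, fun _ _ => ⟨c, tendsto_const_nhds⟩,
    fun _ _ => ⟨c, tendsto_const_nhds⟩⟩

theorem PiecewiseContinuous.prepend_const {E : Type*} [TopologicalSpace E] {g : ℝ → E} {T : ℝ}
    (hg : PiecewiseContinuous g 0 T) (c : E) (t : ℝ) :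
    PiecewiseContinuous (fun s => if s < t then c else g (s - t)) 0 (t + T) := by
  obtain ⟨S, hc, hr, hl⟩ := hg
  have hlt : ∀ s, s < t → (fun s => if s < t then c else g (s - t)) =ᶠ[𝓝 s] fun _ => c :=
    fun s hs => by filter_upwards [Iio_mem_nhds hs] with r hr using if_pos hr
  have hgt : ∀ s, t < s → (fun s => if s < t then c else g (s - t)) =ᶠ[𝓝 s] fun r => g (r - t) :=
    fun s hs => by filter_upwards [Ioi_mem_nhds hs] with r hr using if_neg (not_lt.2 (le_of_lt hr))
  have hsub : ∀ s, Tendsto (fun r : ℝ => r - t) (𝓝 s) (𝓝 (s - t)) := fun s =>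
    (continuous_id.sub continuous_const).tendsto s
  refine ⟨insert t (S.image (· + t)), fun s hs hsS => ?_, fun s hs => ?_, fun s hs => ?_⟩
  · simp only [Finset.mem_insert, Finset.mem_image, not_or, not_exists, not_and] at hsS
    refine ContinuousAt.continuousWithinAt ?_
    rcases lt_or_gt_of_ne hsS.1 with h | h
    · exact continuousAt_const.congr (hlt s h).symm
    · have h1 : ContinuousAt g (s - t) :=
        (hc (s - t) ⟨by linarith, by linarith [hs.2]⟩ fun h' => hsS.2 _ h' (by ring)).continuousAt
          (Ico_mem_nhds (by linarith) (by linarith [hs.2]))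
      exact ContinuousAt.congr (ContinuousAt.comp (f := fun r => r - t) h1 (hsub s)) (hgt s h).symm
  · rcases lt_or_ge s t with h | h
    · exact ⟨c, tendsto_const_nhds.congr' ((hlt s h).symm.filter_mono nhdsWithin_le_nhds)⟩
    · obtain ⟨l, hl'⟩ := hr (s - t) ⟨by linarith, by linarith [hs.2]⟩
      refine ⟨l, Tendsto.congr' (f₁ := fun r => g (r - t)) ?_ (hl'.comp ?_)⟩
      · filter_upwards [self_mem_nhdsWithin] with r hr
        rw [if_neg (not_lt.2 (h.trans (le_of_lt hr)))]
      · refine tendsto_nhdsWithin_iff.2 ⟨(hsub s).mono_left nhdsWithin_le_nhds, ?_⟩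
        filter_upwards [self_mem_nhdsWithin] with r hr
        exact sub_lt_sub_right hr t
  · rcases le_or_gt s t with h | h
    · refine ⟨c, Tendsto.congr' ?_ tendsto_const_nhds⟩
      filter_upwards [self_mem_nhdsWithin] with r hr
      rw [if_pos (lt_of_lt_of_le hr h)]
    · obtain ⟨l, hl'⟩ := hl (s - t) ⟨by linarith, by linarith [hs.2]⟩
      refine ⟨l, Tendsto.congr' ((hgt s h).symm.filter_mono nhdsWithin_le_nhds) (hl'.comp ?_)⟩
      refine tendsto_nhdsWithin_iff.2 ⟨(hsub s).mono_left nhdsWithin_le_nhds, ?_⟩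
      filter_upwards [self_mem_nhdsWithin] with r hr
      exact sub_lt_sub_right hr t

section Flow

variable {E : Type*} [NormedAddCommGroup E] [NormedSpace ℝ E] [CompleteSpace E]

/-- The integral of the flow of `x' = A x`, which maps a constant forcing term to its response. -/
noncomputable def flowIntegral (A : E →L[ℝ] E) (t : ℝ) : E →L[ℝ] E :=
  ∫ s in (0 : ℝ)..t, NormedSpace.exp (s • A)

theorem continuous_flow (A : E →L[ℝ] E) : Continuous fun s : ℝ => NormedSpace.exp (s • A) :=
  continuous_iff_continuousAt.2 fun s => (hasDerivAt_exp_smul_const A s).continuousAt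

theorem hasDerivAt_flowIntegral (A : E →L[ℝ] E) (t : ℝ) :
    HasDerivAt (flowIntegral A) (NormedSpace.exp (t • A)) t :=
  ((continuous_flow A).integral_hasStrictDerivAt 0 t).hasDerivAt

theorem mul_flowIntegral (A : E →L[ℝ] E) (t : ℝ) :
    A * flowIntegral A t = NormedSpace.exp (t • A) - 1 := by
  have h1 := intervalIntegral.integral_eq_sub_of_hasDerivAt (a := 0) (b := t)
    (fun s _ => hasDerivAt_exp_smul_const' (𝕂 := ℝ) A s)
    ((continuous_const.mul (continuous_flow A)).intervalIntegrable _ _)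
  rw [zero_smul, NormedSpace.exp_zero] at h1
  rw [← h1, flowIntegral]
  exact (ContinuousLinearMap.intervalIntegral_comp_comm (ContinuousLinearMap.mul ℝ (E →L[ℝ] E) A)
    ((continuous_flow A).intervalIntegrable _ _)).symm

/-- Variation of constants: the derivative `exp (t • A)` of the flow integral equals `A *
flowIntegral A t + 1`. -/
theorem hasDerivAt_flow_add (A : E →L[ℝ] E) (x b : E) (t : ℝ) :
    HasDerivAt (fun s : ℝ => NormedSpace.exp (s • A) x + flowIntegral A s b)
      (A (NormedSpace.exp (t • A) x + flowIntegral A t b) + b) t := by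
  have h1 := ((hasDerivAt_exp_smul_const' (𝕂 := ℝ) A t).clm_apply (hasDerivAt_const t x)).add
    ((hasDerivAt_flowIntegral A t).clm_apply (hasDerivAt_const t b))
  convert! h1 using 1
  have h2 := congrArg (fun L : E →L[ℝ] E => L b) (mul_flowIntegral A t)
  simp only [mul_apply_eq_comp, sub_apply,
    one_apply_eq_self] at h2
  simp [map_add, h2]
  abel

theorem flow_surjective (A : E →L[ℝ] E) (t : ℝ) :
    Function.Surjective (NormedSpace.exp (t • A) : E →L[ℝ] E) := by
  intro x
  let : NormedAlgebra ℚ (E →L[ℝ] E) := NormedAlgebra.restrictScalars ℚ ℝ _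
  obtain ⟨L, hL⟩ := (NormedSpace.isUnit_exp (t • A)).exists_right_inv
  exact ⟨L x, congrArg (fun L : E →L[ℝ] E => L x) hL⟩

omit [CompleteSpace E] in
-- The right difference quotients at 0 lie in `W`, which is closed.
theorem Submodule.mem_of_hasDerivAt {W : Submodule ℝ E} (hW : IsClosed (W : Set E)) {f : ℝ → E}
    {f' : E} (hf : HasDerivAt f f' 0) (h0 : f 0 ∈ W) (hpos : ∀ s > 0, f s ∈ W) : f' ∈ W := by
  have h1 := (hasDerivAt_iff_tendsto_slope.1 hf).mono_left
    (nhdsWithin_mono 0 (s := Set.Ioi 0) fun s hs => ne_of_gt hs)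
  refine hW.mem_of_tendsto h1 ?_
  filter_upwards [self_mem_nhdsWithin] with s hs
  exact W.smul_mem _ (W.sub_mem (hpos s hs) h0)

end Flow

namespace SwitchedSystem

variable {n N : ℕ} {m : Fin N → ℕ} (Q : SwitchedSystem n N m)

/-- The continuous linear map of the matrix `A_i`. -/
noncomputable def opA (i : Fin N) : (Fin n → ℝ) →L[ℝ] (Fin n → ℝ) :=
  (Q.A i).mulVecLin.toContinuousLinearMap

/-- All states in `W` can be steered to `0` with the same switching signal. -/
def IsSteerable (W : Submodule ℝ (Fin n → ℝ)) : Prop :=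
  ∃ tf : ℝ, 0 < tf ∧ ∃ σ : ℝ → Fin N, PiecewiseContinuous σ 0 tf ∧ ∀ x₀ ∈ W,
    ∃ u : (i : Fin N) → ℝ → (Fin (m i) → ℝ), (∀ i, PiecewiseContinuous (u i) 0 tf) ∧
      ∃ x : ℝ → (Fin n → ℝ), Q.IsTrajectory tf σ u x ∧ x 0 = x₀ ∧ x tf = 0

/-- The states that are steered into `W` by the subsystem `i` with a constant input in
time `t`. -/
noncomputable def pullback (W : Submodule ℝ (Fin n → ℝ)) (i : Fin N) (t : ℝ) :
    Submodule ℝ (Fin n → ℝ) :=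
  (W ⊔ LinearMap.range ((flowIntegral (Q.opA i) t).toLinearMap ∘ₗ (Q.B i).mulVecLin)).comap
    (NormedSpace.exp (t • Q.opA i)).toLinearMap

variable {Q}

theorem isSteerable_bot (i : Fin N) : Q.IsSteerable ⊥ := by
  refine ⟨1, one_pos, fun _ => i, .const i 0 1, fun x₀ hx₀ => ⟨fun _ _ => 0,
    fun _ => .const 0 0 1, fun _ => 0, ⟨continuousOn_const, ∅, fun t _ _ => ?_⟩,
    ((Submodule.mem_bot ℝ).1 hx₀).symm, rfl⟩⟩
  simpa using hasDerivAt_const t (0 : Fin n → ℝ)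

theorem IsSteerable.pullback {W : Submodule ℝ (Fin n → ℝ)} (hW : Q.IsSteerable W) (i : Fin N)
    {t : ℝ} (ht : 0 < t) : Q.IsSteerable (Q.pullback W i t) := by
  obtain ⟨T, hT, σ, hσ, hsteer⟩ := hW
  refine ⟨t + T, by linarith, fun s => if s < t then i else σ (s - t), hσ.prepend_const i t,
    fun x₀ hx₀ => ?_⟩
  obtain ⟨w, hw, _, ⟨v, rfl⟩, hwv⟩ := Submodule.mem_sup.1 (Submodule.mem_comap.1 hx₀)
  obtain ⟨u, hu, x, ⟨hxc, S, hxS⟩, hx0, hxT⟩ := hsteer w hw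
  -- The free flow takes `x₀` to `w` plus the response to `v`, so the constant input `-v` lands at
  -- `w`.
  set y : ℝ → Fin n → ℝ := fun s =>
    NormedSpace.exp (s • Q.opA i) x₀ + flowIntegral (Q.opA i) s ((Q.B i).mulVec (-v)) with hy
  have hyd : ∀ s, HasDerivAt y ((Q.A i).mulVec (y s) + (Q.B i).mulVec (-v)) s := fun s =>
    hasDerivAt_flow_add (Q.opA i) x₀ ((Q.B i).mulVec (-v)) s
  have hyt : y t = x 0 := by
    have h1 : w + flowIntegral (Q.opA i) t ((Q.B i).mulVec v) =
      NormedSpace.exp (t • Q.opA i) x₀ := hwv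
    simp only [hy]
    rw [← h1, Matrix.mulVec_neg, map_neg, add_neg_cancel_right, hx0]
  have hy0 : y 0 = x₀ := by simp [hy, flowIntegral]
  have hlt : ∀ s, s < t → (fun s => if s < t then y s else x (s - t)) =ᶠ[𝓝 s] y :=
    fun s hs => by filter_upwards [Iio_mem_nhds hs] with r hr using if_pos hr
  have hgt : ∀ s, t < s →
      (fun s => if s < t then y s else x (s - t)) =ᶠ[𝓝 s] fun r => x (r - t) :=
    fun s hs => by filter_upwards [Ioi_mem_nhds hs] with r hr using if_neg (not_lt.2 (le_of_lt hr))
  refine ⟨fun j s => if s < t then (Function.update (0 : (j : Fin N) → Fin (m j) → ℝ) i (-v)) j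
      else u j (s - t), fun j => (hu j).prepend_const _ t,
    fun s => if s < t then y s else x (s - t), ⟨?_, insert t (S.image (· + t)), ?_⟩, ?_, ?_⟩
  · rw [← Set.Icc_union_Icc_eq_Icc ht.le (by linarith : t ≤ t + T)]
    refine ContinuousOn.union_of_isClosed ?_ ?_ isClosed_Icc isClosed_Icc
    · refine ContinuousOn.congr (f := y) (fun s _ => (hyd s).continuousAt.continuousWithinAt) ?_
      intro s hs
      rcases hs.2.lt_or_eq with h | rfl
      · exact if_pos h
      · simp [hyt]
    · refine ContinuousOn.congr (f := fun s => x (s - t)) (hxc.comp (by fun_prop) fun s hs =>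
        ⟨by linarith [hs.1], by linarith [hs.2]⟩) fun s hs => if_neg (not_lt.2 hs.1)
  · intro s hs hsS
    simp only [Finset.mem_insert, Finset.mem_image, not_or, not_exists, not_and] at hsS
    rcases lt_or_gt_of_ne hsS.1 with h | h
    · refine ((hyd s).congr_of_eventuallyEq (hlt s h)).congr_deriv ?_
      beta_reduce
      generalize hj : (if s < t then i else σ (s - t)) = j
      obtain rfl : i = j := by rw [← hj, if_pos h]
      simp [h]
    · have h0 : ¬ s < t := not_lt.2 (le_of_lt h)
      have h1 := hxS (s - t) ⟨by linarith, by linarith [hs.2]⟩ fun h' => hsS.2 _ h' (by ring)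
      refine ((h1.comp_sub_const s t).congr_of_eventuallyEq (hgt s h)).congr_deriv ?_
      beta_reduce
      generalize hj : (if s < t then i else σ (s - t)) = j
      obtain rfl : σ (s - t) = j := by rw [← hj, if_neg h0]
      simp [h0]
  · simp [ht, hy0]
  · simp [hT.le, hxT]

theorem finrank_le_finrank_pullback (W : Submodule ℝ (Fin n → ℝ)) (i : Fin N) (t : ℝ) :
    Module.finrank ℝ ↥(W ⊔ LinearMap.range
      ((flowIntegral (Q.opA i) t).toLinearMap ∘ₗ (Q.B i).mulVecLin)) ≤
      Module.finrank ℝ (Q.pullback W i t) := by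
  rw [pullback]
  conv_lhs => rw [← Submodule.map_comap_eq_of_surjective (flow_surjective (Q.opA i) t)
    (W ⊔ LinearMap.range ((flowIntegral (Q.opA i) t).toLinearMap ∘ₗ (Q.B i).mulVecLin))]
  exact Submodule.finrank_map_le _ _

/-- A switched system is controllable if no proper subspace contains the images of the `B_i` and
is invariant under the `A_i`. -/
theorem isControllable_of_forall_submodule (i₀ : Fin N)
    (h : ∀ V : Submodule ℝ (Fin n → ℝ), (∀ i v, (Q.B i).mulVec v ∈ V) →
      (∀ i, ∀ x ∈ V, (Q.A i).mulVec x ∈ V) → V = ⊤) : Q.IsControllable := by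
  let IsMax : Submodule ℝ (Fin n → ℝ) → Prop := fun W => Q.IsSteerable W ∧
    ∀ W', Q.IsSteerable W' → Module.finrank ℝ W' ≤ Module.finrank ℝ W
  obtain ⟨W₀, hW₀⟩ : ∃ W, IsMax W := by
    obtain ⟨W, hW, hmax⟩ := (measure fun W : Submodule ℝ (Fin n → ℝ) =>
      n - Module.finrank ℝ W).wf.has_min {W | Q.IsSteerable W} ⟨⊥, isSteerable_bot i₀⟩
    refine ⟨W, hW, fun W' hW' => ?_⟩
    have h1 : ¬ n - Module.finrank ℝ W' < n - Module.finrank ℝ W := hmax W' hW'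
    have h2 := Submodule.finrank_le W'
    rw [Module.finrank_fin_fun] at h2
    omega
  have hpull : ∀ W, IsMax W → ∀ i, ∀ t > 0,
      (∀ v, flowIntegral (Q.opA i) t ((Q.B i).mulVec v) ∈ W) ∧
      IsMax (W.comap (NormedSpace.exp (t • Q.opA i)).toLinearMap) := by
    intro W hW i t ht
    have h1 := hW.1.pullback i ht
    have h2 := finrank_le_finrank_pullback (Q := Q) W i t
    -- The flow is onto, so the steerable pullback has at least the dimension of the sum; maximality
    -- of `W` forces the sum to be `W`.
    have h3 := Submodule.eq_of_le_of_finrank_le le_sup_left (h2.trans (hW.2 _ h1))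
    refine ⟨fun v => ?_, ?_⟩
    · rw [h3]
      exact Submodule.mem_sup_right ⟨v, rfl⟩
    · rw [pullback, ← h3] at h1
      rw [pullback, ← h3] at h2
      exact ⟨h1, fun W' hW' => (hW.2 W' hW').trans h2⟩
  have hcl : ∀ W : Submodule ℝ (Fin n → ℝ), IsClosed (W : Set (Fin n → ℝ)) := fun W =>
    W.closed_of_finiteDimensional
  -- Pulling back by the flow may change a maximal subspace into another one, so only the
  -- intersection of all of them is seen to be invariant. Differentiating at time 0 yields `B i` and
  -- `A i`.
  have htop : sInf {W | IsMax W} = ⊤ := by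
    refine h _ (fun i v => ?_) fun i x hx => ?_
    · refine Submodule.mem_sInf.2 fun W hW => ?_
      have hd := (hasDerivAt_flowIntegral (Q.opA i) 0).clm_apply
        (hasDerivAt_const (0 : ℝ) ((Q.B i).mulVec v))
      simp only [zero_smul, NormedSpace.exp_zero, map_zero, add_zero,
        one_apply_eq_self] at hd
      exact Submodule.mem_of_hasDerivAt (hcl W) hd (by simp [flowIntegral])
        fun t ht => (hpull W hW i t ht).1 v
    · refine Submodule.mem_sInf.2 fun W hW => ?_
      rw [Submodule.mem_sInf] at hx
      have hd := (hasDerivAt_exp_smul_const (𝕂 := ℝ) (Q.opA i) 0).clm_apply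
        (hasDerivAt_const (0 : ℝ) x)
      simp only [zero_smul, NormedSpace.exp_zero, map_zero, add_zero, one_mul] at hd
      exact Submodule.mem_of_hasDerivAt (hcl W) hd (by simpa using hx W hW)
        fun t ht => hx _ (hpull W hW i t ht).2
  obtain ⟨tf, htf, σ, hσ, hst⟩ := hW₀.1
  refine Set.eq_univ_of_forall fun x₀ => ⟨tf, htf, σ, hσ, hst x₀ ?_⟩
  exact (sInf_le hW₀ : sInf {W | IsMax W} ≤ W₀) (htop ▸ Submodule.mem_top)

end SwitchedSystem

end Control

/-! ### From generalized cacti to weights -/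

section Graph

theorem Cycle.chain_reverse {α : Type*} {r : α → α → Prop} {c : Cycle α}
    (h : c.Chain fun a b => r b a) : c.reverse.Chain r := by
  induction c using Quotient.inductionOn' with
  | _ l =>
    cases l with
    | nil => exact Cycle.Chain.nil r
    | cons a l =>
      have h1 : List.IsChain (fun a b => r b a) (a :: (l ++ [a])) := h
      -- Up to rotation, reversal keeps the base point `a`, so the closed list from `a` to `a` is
      -- just reversed.
      have h2 : ((a :: l : List α) : Cycle α).reverse = (a :: l.reverse : List α) := by
        rw [Cycle.reverse_coe, List.reverse_cons, ← Cycle.coe_cons_eq_coe_append]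
      change ((a :: l : List α) : Cycle α).reverse.Chain r
      rw [h2, Cycle.chain_coe_cons, ← List.reverse_cons, ← List.reverse_concat',
        List.isChain_reverse]
      simpa [flip] using h1

variable {n N : ℕ} {m : Fin N → ℕ}

namespace Vertex

/-- Vertices are state indices or input indices. -/
def equivSum : Vertex n N m ≃ Fin n ⊕ (Σ i : Fin N, Fin (m i)) where
  toFun
    | .state j => .inl j
    | .input i k => .inr ⟨i, k⟩
  invFun
    | .inl j => .state j
    | .inr ⟨i, k⟩ => .input i k
  left_inv := by rintro (_ | _) <;> rfl
  right_inv := by rintro (_ | ⟨_, _⟩) <;> rfl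

noncomputable instance : DecidableEq (Vertex n N m) := Classical.decEq _

noncomputable instance : Fintype (Vertex n N m) := Fintype.ofEquiv _ equivSum.symm

theorem sum_eq (f : Vertex n N m → ℝ) :
    ∑ v, f v = ∑ j, f (.state j) + ∑ i, ∑ k, f (.input i k) := by
  rw [Fintype.sum_equiv equivSum f (fun s => f (equivSum.symm s)) (by simp),
    Fintype.sum_sum_type, Fintype.sum_sigma]
  rfl

/-- The input vertices. -/
def inputs (n N : ℕ) (m : Fin N → ℕ) : Set (Vertex n N m) :=
  {v | ∃ i k, v = .input i k}

theorem exists_eq_state {v : Vertex n N m} (hv : v ∉ inputs n N m) : ∃ j, v = .state j := by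
  cases v with
  | state j => exact ⟨j, rfl⟩
  | input i k => exact absurd ⟨i, k, rfl⟩ hv

end Vertex

namespace StructuredSystem

variable {P : StructuredSystem n N m}

/-- Generating weights of the colored union graph give a controllable realization. -/
theorem isStructurallyControllable_of_generates (i₀ : Fin N)
    {K : Fin N → Matrix (Vertex n N m) (Vertex n N m) ℝ}
    (hK : ∀ i w v, K i w v ≠ 0 → P.IsEdge ⟨v, w, i⟩) (hgen : Generates K (Vertex.inputs n N m)) :
    P.IsStructurallyControllable := by
  refine ⟨⟨fun i => .of fun j k => K i (.state j) (.state k),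
    fun i => .of fun j k => K i (.state j) (.input i k)⟩, ⟨fun i j k h => ?_, fun i j k h => ?_⟩,
    SwitchedSystem.isControllable_of_forall_submodule i₀ fun V hB hA => ?_⟩
  · by_contra h0
    cases hK _ _ _ h0 with
    | state _ _ _ h' => exact h h'
  · by_contra h0
    cases hK _ _ _ h0 with
    | input _ _ _ h' => exact h h'
  · let π : (Vertex n N m → ℝ) →ₗ[ℝ] Fin n → ℝ := LinearMap.funLeft ℝ ℝ Vertex.state
    have htop : V.comap π = ⊤ := by
      refine hgen _ ?_ fun i v hv => ?_
      · rintro _ ⟨i, k, rfl⟩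
        have h0 : π (Pi.single (.input i k) 1) = 0 := by
          funext j
          exact Pi.single_eq_of_ne (by simp) _
        rw [Submodule.mem_comap, h0]
        exact V.zero_mem
      -- The state part of `K i` applied to `v` is `A i` on the states plus `B i` on the inputs of
      -- mode `i`; inputs of other modes have no edges of color `i`.
      · have h0 := V.add_mem (hA i _ hv) (hB i fun k => v (.input i k))
        refine Eq.mp (congrArg (· ∈ V) (funext fun j => ?_)) h0
        have hne : ∀ i', i' ≠ i → ∑ k, K i (.state j) (.input i' k) * v (.input i' k) = 0 := by
          intro i' hi'
          refine Finset.sum_eq_zero fun k _ => ?_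
          have : K i (.state j) (.input i' k) = 0 := by
            by_contra h0
            cases hK _ _ _ h0
            exact hi' rfl
          rw [this, zero_mul]
        change _ = ∑ w, K i (.state j) w * v w
        rw [Vertex.sum_eq, Finset.sum_eq_single i (fun i' _ => hne i') (by simp)]
        rfl
    refine eq_top_iff.2 fun y _ => ?_
    let f : Vertex n N m → ℝ := fun v => match v with
      | .state j => y j
      | .input _ _ => 0
    have hf : f ∈ V.comap π := htop ▸ Submodule.mem_top
    exact hf

/-- An ingoing edge of every vertex: the given one of a state vertex, and a formal loop at an input
vertex. -/
def ingoing (e : Fin n → ColoredEdge n N m) : Vertex n N m → ColoredEdge n N m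
  | .state j => e j
  | .input i k => ⟨.input i k, .input i k, i⟩

theorem head_ingoing {e : Fin n → ColoredEdge n N m} (he : ∀ j, (e j).head = .state j)
    (v : Vertex n N m) : (ingoing e v).head = v := by
  cases v with
  | state j => exact he j
  | input i k => rfl

theorem reflTransGen_iterate_tail {e : Fin n → ColoredEdge n N m} (he : ∀ j, (e j).head = .state j)
    (hP : ∀ j, P.IsEdge (e j)) (v : Vertex n N m) (k : ℕ) :
    Relation.ReflTransGen P.Adj ((fun v => (ingoing e v).tail)^[k] v) v := by
  induction k with
  | zero => exact .refl
  | succ k ih =>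
    rw [Function.iterate_succ_apply']
    generalize (fun v => (ingoing e v).tail)^[k] v = w at ih
    cases w with
    | input i k => exact ih
    | state j =>
      refine .head ⟨(e j).color, ?_⟩ ih
      change P.IsEdge ⟨(e j).tail, .state j, (e j).color⟩
      rw [← he j]
      exact hP j

/-- In an acyclic subgraph every vertex can be traced back to an input vertex. -/
theorem Subgraph.exists_iterate_tail_mem_inputs {G : P.Subgraph} (hG : ∀ c, ¬ G.IsCycle c)
    {e : Fin n → ColoredEdge n N m} (he : ∀ j, (e j).head = .state j)
    (heG : ∀ j, .state j ∈ G.verts → e j ∈ G.edges) {v : Vertex n N m} (hv : v ∈ G.verts) :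
    ∃ k, (fun v => (ingoing e v).tail)^[k] v ∈ Vertex.inputs n N m := by
  by_contra! hno
  set p : Vertex n N m → Vertex n N m := fun v => (ingoing e v).tail with hp
  obtain ⟨k, hk⟩ := exists_iterate_mem_periodicPts p v
  have hmem : ∀ k, p^[k] v ∈ G.verts ∧ ingoing e (p^[k] v) ∈ G.edges := by
    have hedge : ∀ k, p^[k] v ∈ G.verts → ingoing e (p^[k] v) ∈ G.edges := by
      intro k hk
      obtain ⟨j, hj⟩ := Vertex.exists_eq_state (hno k)
      rw [hj] at hk ⊢
      exact heG j hk
    intro k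
    induction k with
    | zero => exact ⟨hv, hedge 0 hv⟩
    | succ k ih =>
      have h1 : p^[k + 1] v ∈ G.verts := by
        rw [Function.iterate_succ_apply']
        exact G.tail_mem _ ih.2
      exact ⟨h1, hedge _ h1⟩
  -- A backward walk avoiding the inputs becomes periodic by finiteness; as `p` runs against the
  -- edges, the reversed orbit is a directed cycle.
  refine hG ((Function.periodicOrbit p (p^[k] v)).reverse.map (ingoing e)) ⟨?_, ?_, ?_, ?_⟩
  · rw [Ne, Cycle.map_eq_nil]
    intro h
    have := congrArg Cycle.reverse h
    rw [Cycle.reverse_reverse, Cycle.reverse_nil,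
      Function.periodicOrbit_eq_nil_iff_not_periodic_pt] at this
    exact this hk
  · intro f hf
    obtain ⟨w, hw, rfl⟩ := Cycle.mem_map.1 hf
    rw [Cycle.mem_reverse_iff, Function.mem_periodicOrbit_iff hk] at hw
    obtain ⟨l, rfl⟩ := hw
    rw [← Function.iterate_add_apply]
    exact (hmem _).2
  · rw [Cycle.chain_map]
    refine Cycle.chain_reverse ((Function.periodicOrbit_chain' _ hk).2 fun l => ?_)
    rw [head_ingoing he, Function.iterate_succ_apply']
  · have h1 : ∀ c : Cycle (Vertex n N m), (c.map (ingoing e)).map ColoredEdge.head = c := by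
      intro c
      induction c using Quotient.inductionOn' with
      | _ l =>
        refine congrArg (fun l : List (Vertex n N m) => (l : Cycle (Vertex n N m)))
          (?_ : List.map ColoredEdge.head (List.map (ingoing e) l) = l)
        rw [List.map_map, List.map_congr_left (f := ColoredEdge.head ∘ ingoing e) (g := id)
          fun v _ => head_ingoing he v, List.map_id]
    rw [h1, Cycle.nodup_reverse_iff]
    exact Function.nodup_periodicOrbit

end StructuredSystem

end Graph

theorem theorem1 (n N : ℕ) (hN : 1 ≤ N) (m : Fin N → ℕ) (P : StructuredSystem n N m)
    (h : P.CoveredByGeneralizedCactus Set.univ) :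
    P.IsStructurallyControllable := by
  obtain ⟨𝒞, hC, hdisj, hcov⟩ := h
  choose G hGC hjG using fun j : Fin n => hcov j trivial
  have hin : ∀ j : Fin n, ∃ e, e ∈ (G j).edges ∧ e.head = .state j := fun j =>
    ((hC _ (hGC j)).elim (fun h => h.one_ingoing j (hjG j))
      (fun h => h.one_ingoing j (hjG j))).exists
  choose e heG he using hin
  have huniq : ∀ H ∈ 𝒞, ∀ j v, v ∈ H.verts → v ∈ (G j).verts → G j = H := fun H hH j v h1 h2 => by
    by_contra hne
    exact Set.disjoint_left.1 (hdisj (hGC j) hH hne) h2 h1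
  have hP : ∀ j, P.IsEdge (e j) := fun j => (G j).isEdge _ (heG j)
  have hreach : ∀ v, ∃ u ∈ Vertex.inputs n N m, Relation.ReflTransGen P.Adj u v := by
    intro v
    cases v with
    | input i k => exact ⟨_, ⟨i, k, rfl⟩, .refl⟩
    | state j =>
      rcases hC _ (hGC j) with hG | hG
      · obtain ⟨k, hk⟩ := StructuredSystem.Subgraph.exists_iterate_tail_mem_inputs hG.no_cycle he
          (fun j' hj' => huniq _ (hGC j) j' _ hj' (hjG j') ▸ heG j') (hjG j)
        exact ⟨_, hk, StructuredSystem.reflTransGen_iterate_tail he hP _ k⟩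
      · obtain ⟨i, k, hik⟩ := hG.reachable j (hjG j)
        exact ⟨_, ⟨i, k, rfl⟩, hik⟩
  obtain ⟨K, hK, hgen⟩ := exists_generating_weights
    (E := fun i v w => P.IsEdge ⟨v, w, i⟩) (I := Vertex.inputs n N m)
    (p := fun v => (StructuredSystem.ingoing e v).tail) (col := fun v => (StructuredSystem.ingoing e v).color)
    (by rintro _ ⟨i, k, rfl⟩; rfl)
    (fun v hv => by
      obtain ⟨j, rfl⟩ := Vertex.exists_eq_state hv
      change P.IsEdge ⟨(e j).tail, .state j, (e j).color⟩
      rw [← he j]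
      exact hP j)
    (fun v hv w hw htail hcol => by
      obtain ⟨j, rfl⟩ := Vertex.exists_eq_state hv
      obtain ⟨k, rfl⟩ := Vertex.exists_eq_state hw
      by_contra hne
      have htail' : (e j).tail = (e k).tail := htail
      -- A common tail lies in both members of the collection, so they coincide, and S-disjointness
      -- of this one subgraph applies.
      have hGjk : G j = G k := huniq _ (hGC k) j _ ((G k).tail_mem _ (heG k))
        (htail' ▸ (G j).tail_mem _ (heG j))
      have hS : StructuredSystem.SDisjoint (G k).edges :=
        (hC _ (hGC k)).elim (fun h => h.sDisjoint) (fun h => h.sDisjoint)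
      have hne' : e j ≠ e k := fun h => hne (by rw [← he j, ← he k, h])
      exact (hS (hGjk ▸ heG j) (heG k) hne').2 htail' hcol)
    hreach
  exact StructuredSystem.isStructurallyControllable_of_generates ⟨0, hN⟩ hK hgen
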